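/- Let $I$ and $O$ be finite disjoint sets of input and output propositions and $\Sigma = I \mathbin{\dot\cup} O$. A hyperproperty is a set of sets of infinite traces in $(2^\Sigma)^\omega$; a closed HyperLTL formula $\varphi$ over $\Sigma$ defines the hyperproperty of all trace sets that satisfy $\varphi$. The formula is universal if it has the form $\forall \pi_1 \ldots \forall \pi_k.\,\psi$ with $\psi$ quantifier-free. In the sequential trace input model, traces are produced one session after the other. A reactive system $S$ determines each output in $2^O$ from the (infinite) input sequences of the finished sessions and the finite input sequence read so far in the current session. A prefix $(U,u)$ consists of a finite sequence $U$ of infinite traces (finished sessions) and a finite trace $u$ (current session); $(U,u) \preceq (V,v)$ holds if either $U=V$ and $u$ is a prefix of $v$, or $V$ continues $U$ with a further session having $u$ as a prefix, and possibly with more sessions. A strategy is a function $\sigma : ((2^\Sigma)^\omega)^* \times (2^\Sigma)^* \to (2^I)^* \to 2^O$. It is losing with $(U,u)$ for a hyperproperty $H$ if there are inputs $v_0, v_1, \ldots \in (2^I)^\omega$ with $U \cup \{t_0,t_1,\ldots\} \notin H$, where $t_0 = u \cdot (v_0[0] \cup \sigma(U,u)(\epsilon)) \cdot (v_0[1] \cup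 \sigma(U,u)(v_0[0])) \cdots$ and, for $k \ge 1$, $t_k = (v_k[0] \cup \sigma(U t_0 \cdots t_{k-1}, \epsilon)(\epsilon)) \cdot (v_k[1] \cup \sigma(U t_0 \cdots t_{k-1}, \epsilon)(v_k[0])) \cdots$. A prefix is winning for $H$ if some strategy is not losing with it. An enforcement mechanism $\mathit{enf}$ is a computable transformation of reactive systems $S$, regarded as black boxes, into reactive systems $\mathit{enf}(S)$: a single algorithm computes each output of $\mathit{enf}(S)$ from the observed run of $S$ (its finished sessions, given as oracles, its current finite session, and its proposed next output). It is sound for $H$ if for all reactive systems $S$ and all infinite sequences of session inputs, the set of traces produced by $\mathit{enf}(S)$ is in $H$. It is transparent for $H$ if, whenever the prefix produced by a system $S$ with an input sequence $s$ is winning for $H$, it is a prefix (w.r.t. $\preceq$) of every prefix that $\mathit{enf}(S)$ produces with an input sequence $s' \succeq s$. A hyperproperty is enforceable if it has a sound and transparent enforcement mechanism. **Theorem.** In the sequential trace input model, enforceability of universal HyperLTL is undecidable: no algorithm decides, given finite $I$, $O$ and a closed universal HyperLTL formula $\varphi$ over $I \mathbin{\dot\cup} O$, whether the hyperproperty defined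 by $\varphi$ is enforceable. -/

import Mathlib

/-! ## Letters and traces

The alphabet is `Σ = I ⊎ O` with `I = Fin m` (inputs) and `O = Fin n` (outputs). Subsets are given
by characteristic functions, and `2^Σ` is identified with `2^I × 2^O`. -/

/-- `2^I`. -/
abbrev InLetter (m : ℕ) : Type := Fin m → Bool

/-- `2^O`. -/
abbrev OutLetter (n : ℕ) : Type := Fin n → Bool

/-- `2^Σ`: the pair `(i, o)` stands for `i ∪ o`. -/
abbrev Letter (m n : ℕ) : Type := InLetter m × OutLetter n

/-- Infinite words over `A`. -/
abbrev InfWord (A : Type) : Type := ℕ → A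

/-- The proposition `a` belongs to the letter `l`. -/
def Letter.Has {m n : ℕ} (l : Letter m n) : Fin m ⊕ Fin n → Prop
  | Sum.inl i => l.1 i = true
  | Sum.inr o => l.2 o = true

/-- The first `k` letters of an infinite word. -/
def InfWord.first {A : Type} (w : InfWord A) (k : ℕ) : List A :=
  (List.range k).map w

/-- The suffix of an infinite word from position `i`. -/
def InfWord.suffix {A : Type} (w : InfWord A) (i : ℕ) : InfWord A :=
  fun j => w (i + j)

/-- The infinite word `u · w`. -/
def InfWord.prepend {A : Type} (u : List A) (w : InfWord A) : InfWord A :=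
  fun j => if h : j < u.length then u[j] else w (j - u.length)

/-- A hyperproperty is a set of sets of infinite traces. -/
abbrev Hyperproperty (m n : ℕ) : Type := Set (Set (InfWord (Letter m n)))

/-! ## HyperLTL -/

/-- Quantifier-free HyperLTL formulas; trace variables are natural numbers. -/
inductive HyperBody (AP : Type) : Type
  | atom (a : AP) (x : ℕ) : HyperBody AP
  | neg (p : HyperBody AP) : HyperBody AP
  | or (p q : HyperBody AP) : HyperBody AP
  | next (p : HyperBody AP) : HyperBody AP
  | untl (p q : HyperBody AP) : HyperBody AP

/-- HyperLTL formulas: a prefix of trace quantifiers followed by a quantifier-free formula. -/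
inductive HyperLTL (AP : Type) : Type
  | body (p : HyperBody AP) : HyperLTL AP
  | all (x : ℕ) (f : HyperLTL AP) : HyperLTL AP
  | ex (x : ℕ) (f : HyperLTL AP) : HyperLTL AP

/-- The trace variables occurring in a quantifier-free formula. -/
def HyperBody.vars {AP : Type} : HyperBody AP → Set ℕ
  | atom _ x => {x}
  | neg p => p.vars
  | or p q => p.vars ∪ q.vars
  | next p => p.vars
  | untl p q => p.vars ∪ q.vars

/-- The free trace variables of a formula. -/
def HyperLTL.freeVars {AP : Type} : HyperLTL AP → Set ℕ
  | body p => p.vars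
  | all x f => f.freeVars \ {x}
  | ex x f => f.freeVars \ {x}

/-- No free trace variables. -/
def HyperLTL.IsClosed {AP : Type} (f : HyperLTL AP) : Prop := f.freeVars = ∅

/-- The universal fragment: all trace quantifiers are universal. -/
def HyperLTL.IsUniversal {AP : Type} : HyperLTL AP → Prop
  | body _ => True
  | all _ f => f.IsUniversal
  | ex _ _ => False

/-- Satisfaction of a quantifier-free formula by a trace assignment. -/
def HyperBody.Sat {m n : ℕ} :
    HyperBody (Fin m ⊕ Fin n) → (ℕ → InfWord (Letter m n)) → Prop
  | atom a x, A => (A x 0).Has a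
  | neg p, A => ¬ p.Sat A
  | or p q, A => p.Sat A ∨ q.Sat A
  | next p, A => p.Sat (fun x => (A x).suffix 1)
  | untl p q, A => ∃ i, q.Sat (fun x => (A x).suffix i) ∧
      ∀ j, j < i → p.Sat (fun x => (A x).suffix j)

/-- Satisfaction of a formula by a trace set and a trace assignment. -/
def HyperLTL.Sat {m n : ℕ} (T : Set (InfWord (Letter m n))) :
    HyperLTL (Fin m ⊕ Fin n) → (ℕ → InfWord (Letter m n)) → Prop
  | body p, A => p.Sat A
  | all x f, A => ∀ t ∈ T, f.Sat T (Function.update A x t)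
  | ex x f, A => ∃ t ∈ T, f.Sat T (Function.update A x t)

/-- The hyperproperty defined by a closed formula. The value of the initial trace assignment is
irrelevant for closed formulas; it plays the role of the empty assignment. -/
def HyperLTL.hyperproperty {m n : ℕ} (f : HyperLTL (Fin m ⊕ Fin n)) : Hyperproperty m n :=
  {T | f.Sat T (fun _ _ => (fun _ => false, fun _ => false))}

/-- Gödel numbering of quantifier-free formulas. -/
def HyperBody.code {AP : Type} [Encodable AP] : HyperBody AP → ℕ
  | atom a x => 5 * Nat.pair (Encodable.encode a) x
  | neg p => 5 * p.code + 1
  | or p q => 5 * Nat.pair p.code q.code + 2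
  | next p => 5 * p.code + 3
  | untl p q => 5 * Nat.pair p.code q.code + 4

/-- Gödel numbering of formulas. -/
def HyperLTL.code {AP : Type} [Encodable AP] : HyperLTL AP → ℕ
  | body p => 3 * p.code
  | all x f => 3 * Nat.pair x f.code + 1
  | ex x f => 3 * Nat.pair x f.code + 2

theorem HyperBody.code_injective {AP : Type} [Encodable AP] :
    Function.Injective (HyperBody.code (AP := AP)) := by
  intro p
  induction p with
  | atom a x =>
    intro q h
    cases q <;> simp only [HyperBody.code] at h <;> try omega
    have h' := Nat.pair_eq_pair.1 (Nat.eq_of_mul_eq_mul_left (by norm_num) h)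
    rw [Encodable.encode_injective h'.1, h'.2]
  | neg p ih =>
    intro q h
    cases q <;> simp only [HyperBody.code] at h <;> try omega
    exact congrArg _ (ih (by omega))
  | next p ih =>
    intro q h
    cases q <;> simp only [HyperBody.code] at h <;> try omega
    exact congrArg _ (ih (by omega))
  | or p q ihp ihq =>
    intro r h
    cases r <;> simp only [HyperBody.code] at h <;> try omega
    have h' := Nat.pair_eq_pair.1 (Nat.eq_of_mul_eq_mul_left (by norm_num) (Nat.add_right_cancel h))
    rw [ihp h'.1, ihq h'.2]
  | untl p q ihp ihq =>
    intro r h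
    cases r <;> simp only [HyperBody.code] at h <;> try omega
    have h' := Nat.pair_eq_pair.1 (Nat.eq_of_mul_eq_mul_left (by norm_num) (Nat.add_right_cancel h))
    rw [ihp h'.1, ihq h'.2]

theorem HyperLTL.code_injective {AP : Type} [Encodable AP] :
    Function.Injective (HyperLTL.code (AP := AP)) := by
  intro f
  induction f with
  | body p =>
    intro g h
    cases g <;> simp only [HyperLTL.code] at h <;> try omega
    rw [HyperBody.code_injective (Nat.eq_of_mul_eq_mul_left (by norm_num) h)]
  | all x f ih =>
    intro g h
    cases g <;> simp only [HyperLTL.code] at h <;> try omega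
    have h' := Nat.pair_eq_pair.1 (Nat.eq_of_mul_eq_mul_left (by norm_num) (Nat.add_right_cancel h))
    rw [h'.1, ih h'.2]
  | ex x f ih =>
    intro g h
    cases g <;> simp only [HyperLTL.code] at h <;> try omega
    have h' := Nat.pair_eq_pair.1 (Nat.eq_of_mul_eq_mul_left (by norm_num) (Nat.add_right_cancel h))
    rw [h'.1, ih h'.2]

/-! ## The sequential trace input model -/

/-- A prefix `(U, u)`: finitely many finished sessions and a finite current session. -/
abbrev SeqPrefix (A : Type) : Type := List (InfWord A) × List A

/-- `(U, u) ⪯ (V, v)`: either `U = V` and `u` is a prefix of `v`, or `V` continues `U` with a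
session that has `u` as a prefix and possibly with further sessions. -/
def SeqPrefix.Le {A : Type} (p q : SeqPrefix A) : Prop :=
  (p.1 = q.1 ∧ p.2 <+: q.2) ∨
    ∃ (w : InfWord A) (W : List (InfWord A)),
      q.1 = p.1 ++ w :: W ∧ p.2 = w.first p.2.length

/-- The trace obtained by answering the inputs `v` with `s : (2^I)^* → 2^O`; the output at
position `j` depends on the inputs at positions before `j`. -/
def respond {m n : ℕ} (s : List (InLetter m) → OutLetter n) (v : InfWord (InLetter m)) :
    InfWord (Letter m n) :=
  fun j => (v j, s (v.first j))

/-- Prefixed strategies `((2^Σ)^ω)^* × (2^Σ)^* → (2^I)^* → 2^O`. -/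
abbrev SeqStrategy (m n : ℕ) : Type :=
  SeqPrefix (Letter m n) → List (InLetter m) → OutLetter n

/-- The sequence `U, t₀, …, t_k` of sessions that results when `σ` continues the prefix
`p = (U, u)` on the inputs `V = (v₀, v₁, …)`. -/
def SeqStrategy.play {m n : ℕ} (σ : SeqStrategy m n) (p : SeqPrefix (Letter m n))
    (V : ℕ → InfWord (InLetter m)) : ℕ → List (InfWord (Letter m n))
  | 0 => p.1 ++ [InfWord.prepend p.2 (respond (σ p) (V 0))]
  | k + 1 => σ.play p V k ++ [respond (σ (σ.play p V k, [])) (V (k + 1))]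

/-- `σ` is losing with the prefix `p = (U, u)` for `H`: for some inputs, the set
`U ∪ {t₀, t₁, …}` is not in `H`. -/
def SeqStrategy.Losing {m n : ℕ} (σ : SeqStrategy m n) (p : SeqPrefix (Letter m n))
    (H : Hyperproperty m n) : Prop :=
  ∃ V : ℕ → InfWord (InLetter m), {t | ∃ k, t ∈ σ.play p V k} ∉ H

/-- A prefix is winning if some strategy is not losing with it. -/
def SeqPrefix.Winning {m n : ℕ} (p : SeqPrefix (Letter m n)) (H : Hyperproperty m n) : Prop :=
  ∃ σ : SeqStrategy m n, ¬ σ.Losing p H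

/-! ## Reactive systems and enforcement mechanisms -/

/-- A (black-box) reactive system in the sequential model: the inputs of the finished sessions and
the inputs seen so far in the current session determine the next output. -/
abbrev SeqSystem (m n : ℕ) : Type :=
  List (InfWord (InLetter m)) → List (InLetter m) → OutLetter n

/-- The traces of the sessions that `S` produces on the inputs `V = (v₀, v₁, …)`. -/
def SeqSystem.session {m n : ℕ} (S : SeqSystem m n) (V : ℕ → InfWord (InLetter m)) (k : ℕ) :
    InfWord (Letter m n) :=
  respond (S ((List.range k).map V)) (V k)

/-- The prefix that `S` produces with the input sequence `s = (V, v)`. -/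
def SeqSystem.run {m n : ℕ} (S : SeqSystem m n) (s : SeqPrefix (InLetter m)) :
    SeqPrefix (Letter m n) :=
  (List.ofFn fun k : Fin s.1.length => respond (S (s.1.take k)) s.1[k],
   List.ofFn fun j : Fin s.2.length => (s.2[j], S s.1 (s.2.take j)))

/-- `enf` is a computable transformation of black-box systems: one algorithm computes every output
of `enf S` from the observed behaviour of `S`, that is, the finished sessions of `S`, its current
finite session and its proposed next output. The finished sessions are infinite words, so the
algorithm is given their first `k` letters for `k = 0, 1, 2, …`, and answers `none` as long as it
has to read more. -/
def IsEnforcementMechanism {m n : ℕ} (enf : SeqSystem m n → SeqSystem m n) : Prop :=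
  ∃ F : ℕ × List (List (Letter m n)) × List (Letter m n) × OutLetter n → Option (OutLetter n),
    Computable F ∧
    ∀ (S : SeqSystem m n) (V : List (InfWord (InLetter m))) (v : List (InLetter m)),
      (∃ k, F (k, (S.run (V, v)).1.map (fun t => t.first k), (S.run (V, v)).2, S V v)
        = some (enf S V v)) ∧
      ∀ k o, F (k, (S.run (V, v)).1.map (fun t => t.first k), (S.run (V, v)).2, S V v) = some o →
        o = enf S V v

/-- Soundness: the set of traces produced by `enf S` is always in `H`. -/
def EnfSound {m n : ℕ} (enf : SeqSystem m n → SeqSystem m n) (H : Hyperproperty m n) : Prop :=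
  ∀ (S : SeqSystem m n) (V : ℕ → InfWord (InLetter m)), Set.range ((enf S).session V) ∈ H

/-- Transparency: if the prefix that `S` produces with the input sequence `s` is winning, then it
is a prefix of whatever `enf S` produces with an input sequence that extends `s`. -/
def EnfTransparent {m n : ℕ} (enf : SeqSystem m n → SeqSystem m n) (H : Hyperproperty m n) :
    Prop :=
  ∀ (S : SeqSystem m n) (s s' : SeqPrefix (InLetter m)),
    (S.run s).Winning H → s.Le s' → (S.run s).Le ((enf S).run s')

/-- `H` is enforceable in the sequential model: there is a sound and transparent enforcement
mechanism. -/
def Enforceable {m n : ℕ} (H : Hyperproperty m n) : Prop :=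
  ∃ enf : SeqSystem m n → SeqSystem m n,
    IsEnforcementMechanism enf ∧ EnfSound enf H ∧ EnfTransparent enf H

/-! Halting is reduced to non-enforceability. A fixed machine, started on `2 ^ e`, is turned into a
cellular rule on one-sided rows of output letters. There is one input proposition; its first
occurrence in a session, at position `t`, asks for the `t`-th row of the computation, which the
outputs must spell out from position `t + 1` on. A universal formula on pairs of sessions can check
this: the row asked for at `0` is initial, rows asked for at `t` and `t + 1` are successive, and no
row is terminal (`CellRule.exists_formula`).

The environment may ask for every row, and then induction on `t` forces all outputs
(`CellRule.output_eq_answer`). If the machine halts, some forced row is terminal, so not even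
soundness is possible (`CellRule.not_halts_of_enforceable`). If it does not halt, always writing the
true rows is a computable sound strategy. Since the missing requests can still follow any prefix, a
winning prefix agrees with this strategy (`CellRule.run_eq_of_winning`), so ignoring the proposed
outputs is transparent (`CellRule.enforceable_of_not_halts`). A decision procedure would thus
contradict `exists_cellRule_outLetter_not_computablePred`. -/

/-! ### A fixed program with undecidable halting problem -/

section TuringMachines

open Turing

theorem primrec_two_pow : Primrec fun k : ℕ => 2 ^ k :=
  (Primrec.nat_rec₁ (f := fun _ b => 2 * b) 1
    (Primrec.nat_mul.comp (Primrec.const 2) Primrec.snd)).of_eq fun k => by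
      induction k with
      | zero => rfl
      | succ k ih => simp only at ih ⊢; rw [ih, pow_succ, mul_comm]

/-- There is a fixed code whose halting problem on the inputs `2 ^ e` is undecidable. -/
theorem exists_toPartrec_code_not_computablePred :
    ∃ c : ToPartrec.Code, ¬ ComputablePred fun e : ℕ => (c.eval [2 ^ e]).Dom := by
  -- Unbounded search recovers `e` from `2 ^ e`; then the program with number `e` is run on `0`.
  let g : ℕ →. ℕ := fun N => (Nat.rfind fun k => Part.some (decide (2 ^ k = N))).bind
    fun e => Nat.Partrec.Code.eval (Denumerable.ofNat Nat.Partrec.Code e) 0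
  have hg : Partrec g := by
    refine Partrec.bind (Partrec.rfind (p := fun N k => Part.some (decide (2 ^ k = N))) ?_) ?_
    · have : PrimrecRel fun N k : ℕ => 2 ^ k = N :=
        Primrec.eq.comp (primrec_two_pow.comp Primrec.snd) Primrec.fst
      exact this.decide.to_comp.partrec
    · exact Nat.Partrec.Code.eval_part.comp ((Computable.ofNat _).comp Computable.snd)
        (Computable.const 0)
  have hg2 (e : ℕ) : g (2 ^ e) =
      Nat.Partrec.Code.eval (Denumerable.ofNat Nat.Partrec.Code e) 0 := by
    have : (Nat.rfind fun k => Part.some (decide (2 ^ k = 2 ^ e))) = Part.some e := by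
      refine Part.eq_some_iff.2 (Nat.mem_rfind.2 ⟨by simp, fun {m} hm => ?_⟩)
      simp; omega
    simp only [g, this, Part.bind_some]
  obtain ⟨c, hc⟩ := ToPartrec.Code.exists_code (n := 1) (f := fun v => g v.head)
    (Nat.Partrec'.part_iff.2 (hg.comp Primrec.vector_head.to_comp))
  refine ⟨c, fun h => ComputablePred.halting_problem 0 ?_⟩
  have h2 : ∀ e, (c.eval [2 ^ e]).Dom ↔
      (Nat.Partrec.Code.eval (Denumerable.ofNat Nat.Partrec.Code e) 0).Dom := by
    intro e
    have := hc (2 ^ e ::ᵥ List.Vector.nil)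
    rw [show (2 ^ e ::ᵥ List.Vector.nil : List.Vector ℕ 1).1 = [2 ^ e] from rfl] at this
    rw [this, List.Vector.head_cons, hg2]
    rfl
  obtain ⟨f, hf, hfe⟩ := ComputablePred.computable_iff.1 h
  refine ComputablePred.computable_iff.2 ⟨fun c => f (Encodable.encode c),
    hf.comp Computable.encode, ?_⟩
  funext c
  rw [← congrFun hfe, eq_iff_iff, h2, Denumerable.ofNat_encode]

/-- Digits are written least significant first. Powers of two are used as inputs because `e` then
enters the initial row only as the length of a constant block. -/
theorem trNat_two_pow (e : ℕ) :
    PartrecToTM2.trNat (2 ^ e) =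
      List.replicate e PartrecToTM2.Γ'.bit0 ++ [PartrecToTM2.Γ'.bit1] := by
  have h : ∃ q : PosNum, ((2 ^ e : ℕ) : Num) = Num.pos q ∧ PartrecToTM2.trPosNum q =
      List.replicate e PartrecToTM2.Γ'.bit0 ++ [PartrecToTM2.Γ'.bit1] := by
    induction e with
    | zero => exact ⟨1, rfl, rfl⟩
    | succ e ih =>
      obtain ⟨q, h1, h2⟩ := ih
      refine ⟨q.bit0, ?_, ?_⟩
      · apply Num.to_nat_inj.1
        simp only [Num.to_of_nat, Num.cast_pos, PosNum.cast_bit0, pow_succ]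
        have : ((q : ℕ)) = 2 ^ e := by rw [← Num.to_of_nat (2 ^ e), h1]; rfl
        rw [this]; ring
      · simp [PartrecToTM2.trPosNum, h2, List.replicate_succ]
  obtain ⟨q, h1, h2⟩ := h
  rw [PartrecToTM2.trNat, h1, PartrecToTM2.trNum, h2]

/-! ### Cellular rules on one-sided rows -/

/-- The local rule of a one-sided array of cells whose cell at the origin is visible everywhere,
together with the data of initial rows and a set of terminal letters. -/
structure CellRule (A : Type) where
  boundary : A → A → A
  interior : A → A → A → A → A
  first : A
  second : A
  repeated : A
  blank : A
  halted : Set A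

namespace CellRule

variable {A B : Type}

/-- The initial row consists of two fixed letters, `e` copies of a third letter, and blanks. -/
def init (R : CellRule A) (e : ℕ) : ℕ → A
  | 0 => R.first
  | 1 => R.second
  | p + 2 => if p < e then R.repeated else R.blank

/-- Applies the rule to a row. -/
def next (R : CellRule A) (r : ℕ → A) : ℕ → A
  | 0 => R.boundary (r 0) (r 1)
  | p + 1 => R.interior (r 0) (r p) (r (p + 1)) (r (p + 2))

/-- The `t`-th row for the initial row with parameter `e`. -/
def row (R : CellRule A) (e : ℕ) : ℕ → ℕ → A
  | 0 => R.init e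
  | t + 1 => R.next (R.row e t)

/-- Some row has a terminal letter at the origin. -/
def Halts (R : CellRule A) (e : ℕ) : Prop := ∃ t, R.row e t 0 ∈ R.halted

/-- Transport along an encoding of letters. -/
def map (R : CellRule A) (enc : A → B) (dec : B → A) : CellRule B where
  boundary x y := enc (R.boundary (dec x) (dec y))
  interior x y z w := enc (R.interior (dec x) (dec y) (dec z) (dec w))
  first := enc R.first
  second := enc R.second
  repeated := enc R.repeated
  blank := enc R.blank
  halted := dec ⁻¹' R.halted

theorem row_map (R : CellRule A) {enc : A → B} {dec : B → A} (h : ∀ a, dec (enc a) = a)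
    (e t p : ℕ) : (R.map enc dec).row e t p = enc (R.row e t p) := by
  induction t generalizing p with
  | zero =>
    match p with
    | 0 => rfl
    | 1 => rfl
    | p + 2 => simp only [row, init, map]; split_ifs <;> rfl
  | succ t ih => cases p <;> simp only [row, next, ih] <;> simp only [map, h]

theorem halts_map (R : CellRule A) {enc : A → B} {dec : B → A} (h : ∀ a, dec (enc a) = a)
    (e : ℕ) : (R.map enc dec).Halts e ↔ R.Halts e := by
  refine exists_congr fun t => ?_
  rw [row_map R h]
  simp only [map, Set.mem_preimage, h]

end CellRule

/-! ### Turing machines as cellular rules, with the tape folded at the head -/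

section PostTuring

variable {Γ Λ : Type} [Inhabited Γ] [Inhabited Λ]

/-- The configuration after `t` steps, `none` after the machine has stopped. -/
def Turing.TM0.run (M : TM0.Machine Γ Λ) (l : List Γ) (t : ℕ) : Option (TM0.Cfg Γ Λ) :=
  (fun c => c.bind (TM0.step M))^[t] (some (TM0.init l))

theorem Turing.TM0.run_succ (M : TM0.Machine Γ Λ) (l : List Γ) (t : ℕ) :
    TM0.run M l (t + 1) = (TM0.run M l t).bind (TM0.step M) := by
  rw [TM0.run, Function.iterate_succ_apply', TM0.run]

theorem Turing.TM0.eval_dom_iff_run_eq_none (M : TM0.Machine Γ Λ) (l : List Γ) :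
    (TM0.eval M l).Dom ↔ ∃ t, TM0.run M l t = none := by
  have hrun : ∀ t c, TM0.run M l t = some c →
      StateTransition.Reaches (TM0.step M) (TM0.init l) c := by
    intro t
    induction t with
    | zero => intro c h; cases h; exact Relation.ReflTransGen.refl
    | succ t ih =>
      intro c h
      rw [TM0.run_succ, Option.bind_eq_some_iff] at h
      obtain ⟨d, hd, h⟩ := h
      exact (ih d hd).tail h
  have hdom : (TM0.eval M l).Dom ↔
      ∃ b, b ∈ StateTransition.eval (TM0.step M) (TM0.init l) :=
    Part.dom_iff_mem (o := StateTransition.eval (TM0.step M) (TM0.init l))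
  rw [hdom]
  constructor
  · rintro ⟨b, hb⟩
    obtain ⟨h1, h2⟩ := StateTransition.mem_eval.1 hb
    have : ∃ t, TM0.run M l t = some b := by
      clear hb h2
      induction h1 with
      | refl => exact ⟨0, rfl⟩
      | tail _ h ih =>
        obtain ⟨t, ht⟩ := ih
        exact ⟨t + 1, by rw [TM0.run_succ, ht]; exact h⟩
    obtain ⟨t, ht⟩ := this
    exact ⟨t + 1, by rw [TM0.run_succ, ht]; exact h2⟩
  · rintro ⟨t, ht⟩
    -- Going back from `none`, the last configuration before it is the one without successor.
    induction t with
    | zero => cases ht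
    | succ t ih =>
      cases hc : TM0.run M l t with
      | none => exact ih hc
      | some c =>
        rw [TM0.run_succ, hc] at ht
        exact ⟨c, StateTransition.mem_eval.2 ⟨hrun t c hc, ht⟩⟩

/-- The configurations of a Turing machine as rows: the letter at position `p` holds the state (or
`none` after halting) and the symbols at distance `p` to the right of the head and at distance
`p + 1` to its left. -/
def Turing.TM0.rowOf (S : Finset Λ) [DecidableEq Λ] (c : TM0.Cfg Γ Λ) (p : ℕ) :
    Option S × Γ × Γ :=
  (if h : c.q ∈ S then some ⟨c.q, h⟩ else none, c.Tape.nth p, c.Tape.nth (-(p + 1)))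

/-- The letter at position `p` of the next row, given the head letter and the letters at
positions `p - 1`, `p` and `p + 1`; for `p = 0`, the letter on the left is the mirror image of the
head letter. -/
def Turing.TM0.cellStep (M : TM0.Machine Γ Λ) (S : Finset Λ) [DecidableEq Λ] (origin : Bool)
    (x l c r : Option S × Γ × Γ) : Option S × Γ × Γ :=
  match x.1 with
  | none => (none, c.2)
  | some q =>
    match M q x.2.1 with
    | none => (none, c.2)
    | some (q', s) =>
      (if h : q' ∈ S then some ⟨q', h⟩ else none,
        match s with
        | .move .right => (r.2.1, l.2.2)
        | .move .left => (l.2.1, r.2.2)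
        | .write a => (if origin then a else c.2.1, c.2.2))

/-- Seen from the head, a move shifts the whole tape by one, so a cell needs only its neighbours and
the head letter. The left neighbour is given by tape positions to cover `p = 0`, where it is the
head letter with its symbols exchanged; its state component `o` is never read. -/
theorem Turing.TM0.cellStep_rowOf (M : TM0.Machine Γ Λ) (S : Finset Λ) [DecidableEq Λ]
    {c c' : TM0.Cfg Γ Λ} (hc : c.q ∈ S) (h : TM0.step M c = some c') (o : Option S) (p : ℕ) :
    TM0.cellStep M S (decide (p = 0)) (TM0.rowOf S c 0) (o, c.Tape.nth (p - 1), c.Tape.nth (-p))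
      (TM0.rowOf S c p) (TM0.rowOf S c (p + 1)) = TM0.rowOf S c' p := by
  obtain ⟨q, T⟩ := c
  obtain ⟨⟨q', s⟩, h1, rfl⟩ := Option.map_eq_some_iff.1 h
  simp only at hc
  have h0 : T.nth ((0 : ℕ) : ℤ) = T.head := rfl
  simp only [rowOf, hc, cellStep, h0, h1, dif_pos]
  rcases s with (_ | _) | a
  · simp only [Tape.move_left_nth]
    refine Prod.ext rfl (Prod.ext rfl ?_)
    simp only
    congr 1
  · simp only [Tape.move_right_nth]
    refine Prod.ext rfl (Prod.ext ?_ ?_)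
    · simp
    · simp only
      congr 1
      ring
  · simp only [Tape.write_nth]
    refine Prod.ext rfl (Prod.ext ?_ ?_)
    · by_cases hp : p = 0 <;> simp [hp]
    · have : ¬ (-((p : ℤ) + 1) = 0) := by omega
      rw [if_neg this]

/-- The rule simulating a Turing machine on the inputs `x y z ⋯ z`. -/
noncomputable def Turing.TM0.cellRule (M : TM0.Machine Γ Λ) (S : Finset Λ) [DecidableEq Λ]
    (q₀ : Option S) (x y z : Γ) : CellRule (Option S × Γ × Γ) where
  boundary a b := TM0.cellStep M S true a (a.1, a.2.2, a.2.1) a b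
  interior x a b c := TM0.cellStep M S false x a b c
  first := (q₀, x, default)
  second := (q₀, y, default)
  repeated := (q₀, z, default)
  blank := (q₀, default, default)
  halted := {a | a.1 = none}

theorem Turing.TM0.next_rowOf (M : TM0.Machine Γ Λ) (S : Finset Λ) [DecidableEq Λ]
    (q₀ : Option S) (x y z : Γ) {c c' : TM0.Cfg Γ Λ} (hc : c.q ∈ S)
    (h : TM0.step M c = some c') :
    (TM0.cellRule M S q₀ x y z).next (TM0.rowOf S c) = TM0.rowOf S c' := by
  funext p
  cases p with
  | zero => exact TM0.cellStep_rowOf M S hc h _ 0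
  | succ p =>
    rw [← TM0.cellStep_rowOf M S hc h (TM0.rowOf S c p).1 (p + 1)]
    simp only [CellRule.next, cellRule, rowOf, Nat.cast_add, Nat.cast_one, add_sub_cancel_right]
    rfl

/-- All cells take their state from the head letter, so a missing state there persists. -/
theorem Turing.TM0.next_zero_of_halted (M : TM0.Machine Γ Λ) (S : Finset Λ) [DecidableEq Λ]
    (q₀ : Option S) (x y z : Γ) {r : ℕ → Option S × Γ × Γ} (h : (r 0).1 = none) :
    ((TM0.cellRule M S q₀ x y z).next r 0).1 = none := by
  simp only [CellRule.next, cellRule, cellStep]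
  rw [h]

theorem Turing.TM0.next_zero_of_step_eq_none (M : TM0.Machine Γ Λ) (S : Finset Λ)
    [DecidableEq Λ] (q₀ : Option S) (x y z : Γ) {c : TM0.Cfg Γ Λ} (hc : c.q ∈ S)
    (h : TM0.step M c = none) :
    ((TM0.cellRule M S q₀ x y z).next (TM0.rowOf S c) 0).1 = none := by
  obtain ⟨q, T⟩ := c
  have h1 : M q T.head = none := by simpa [TM0.step] using h
  simp only at hc
  have h0 : T.nth ((0 : ℕ) : ℤ) = T.head := rfl
  simp only [CellRule.next, cellRule, rowOf, hc, cellStep, h0, h1, dif_pos]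

theorem Turing.TM0.init_eq_rowOf (M : TM0.Machine Γ Λ) (S : Finset Λ) [DecidableEq Λ]
    (h : default ∈ S) (x y z : Γ) (e : ℕ) :
    (TM0.cellRule M S (some ⟨default, h⟩) x y z).init e =
      TM0.rowOf S (TM0.init (x :: y :: List.replicate e z)) := by
  have hl (p : ℕ) : (Tape.mk₁ (x :: y :: List.replicate e z)).nth (-((p : ℤ) + 1)) = default := by
    rw [show -((p : ℤ) + 1) = Int.negSucc p from rfl]
    simp only [Tape.mk₁, Tape.mk₂, Tape.mk', Tape.nth, ListBlank.nth_mk]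
    rfl
  have hr (p : ℕ) : (Tape.mk₁ (x :: y :: List.replicate e z)).nth p =
      (x :: y :: List.replicate e z).getI p := by
    rw [Tape.mk₁, Tape.mk₂, Tape.mk'_nth_nat, ListBlank.nth_mk]
  funext p
  have hq : TM0.rowOf S (TM0.init (x :: y :: List.replicate e z)) p =
      (some ⟨default, h⟩, (x :: y :: List.replicate e z).getI p, default) := by
    rw [← hl p, ← hr p]
    exact Prod.ext (dif_pos h) rfl
  rw [hq]
  match p with
  | 0 => rfl
  | 1 => rfl
  | p + 2 =>
    simp only [CellRule.init, cellRule, List.getI, List.getD_cons_succ]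
    by_cases hp : p < e <;> simp [hp]

theorem Turing.TM0.halts_cellRule_iff (M : TM0.Machine Γ Λ) (S : Finset Λ) [DecidableEq Λ]
    (hS : TM0.Supports M S) (x y z : Γ) (e : ℕ) :
    (TM0.cellRule M S (some ⟨default, hS.1⟩) x y z).Halts e ↔
      (TM0.eval M (x :: y :: List.replicate e z)).Dom := by
  rw [TM0.eval_dom_iff_run_eq_none]
  set R := TM0.cellRule M S (some ⟨default, hS.1⟩) x y z with hR
  set l := x :: y :: List.replicate e z with hl
  -- After halting, a row need not encode a configuration; the invariant keeps only the missing
  -- state at the origin.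
  have key : ∀ t, (∃ c, TM0.run M l t = some c ∧ c.q ∈ S ∧ R.row e t = TM0.rowOf S c) ∨
      (TM0.run M l t = none ∧ (R.row e t 0).1 = none) := by
    intro t
    induction t with
    | zero => exact Or.inl ⟨_, rfl, hS.1, TM0.init_eq_rowOf M S hS.1 x y z e⟩
    | succ t ih =>
      rw [TM0.run_succ, CellRule.row]
      rcases ih with ⟨c, hc, hq, hr⟩ | ⟨hn, hr⟩
      · rw [hc, Option.bind_some, hr]
        cases hs : TM0.step M c with
        | none => exact Or.inr ⟨rfl, TM0.next_zero_of_step_eq_none M S _ x y z hq hs⟩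
        | some c' =>
          exact Or.inl ⟨c', rfl, TM0.step_supports M hS hs hq, TM0.next_rowOf M S _ x y z hq hs⟩
      · rw [hn]
        exact Or.inr ⟨rfl, TM0.next_zero_of_halted M S _ x y z hr⟩
  refine exists_congr fun t => ?_
  rcases key t with ⟨c, hc, hq, hr⟩ | ⟨hn, hr⟩
  · rw [hr, hc]
    simp [hR, cellRule, rowOf, hq]
  · exact iff_of_true hr hn

end PostTuring

/-! ### A cellular rule with undecidable halting problem -/

section Universal

open PartrecToTM2

theorem PartrecToTM2.finite_K' : Finite K' :=
  Finite.of_surjective (fun i : Fin 4 => ![K'.main, K'.rev, K'.aux, K'.stack] i) fun k => by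
    cases k
    exacts [⟨0, rfl⟩, ⟨1, rfl⟩, ⟨2, rfl⟩, ⟨3, rfl⟩]

theorem exists_cellRule_not_computablePred :
    ∃ (A : Type) (_ : Finite A) (R : CellRule A), ¬ ComputablePred R.Halts := by
  classical
  obtain ⟨c, hc⟩ := exists_toPartrec_code_not_computablePred
  have := PartrecToTM2.finite_K'
  -- The machine starts in the default state, so this choice of default loads the program `c`.
  let _ : Inhabited PartrecToTM2.Λ' := ⟨trNormal c Cont'.halt⟩
  let sym (a : PartrecToTM2.Γ') : TM2to1.Γ' K' (fun _ => PartrecToTM2.Γ') :=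
    (false, Function.update (fun _ => none) K'.main (some a))
  let bottom : TM2to1.Γ' K' (fun _ => PartrecToTM2.Γ') := (true, (sym .cons).2)
  let step : Λ' → TM2.Stmt (fun _ : K' => PartrecToTM2.Γ') Λ' (Option PartrecToTM2.Γ') := tr
  let M := TM1to0.tr (TM2to1.tr step)
  have hM (e : ℕ) : (TM0.eval M (bottom :: sym .bit1 :: List.replicate e (sym .bit0))).Dom ↔
      (c.eval [2 ^ e]).Dom := by
    -- The tape stores a stack from its bottom upwards, hence the reversal; the bottom cell carries
    -- the flag `true`, which is why the first letter differs from a plain symbol.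
    have h1 : TM2to1.trInit (Γ := fun _ => PartrecToTM2.Γ') K'.main (trList [2 ^ e]) =
        bottom :: sym .bit1 :: List.replicate e (sym .bit0) := by
      have h : (trList [2 ^ e]).reverse =
          Γ'.cons :: Γ'.bit1 :: List.replicate e Γ'.bit0 := by
        simp [trNat_two_pow]
      rw [TM2to1.trInit, h]
      exact congrArg (fun l => bottom :: sym .bit1 :: l) List.map_replicate
    have h2 : TM2.init K'.main (trList [2 ^ e]) = PartrecToTM2.init c [2 ^ e] := by
      simp only [TM2.init, PartrecToTM2.init]
      congr 1
      funext k
      cases k <;> rfl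
    have h3 : (TM2.eval step K'.main (trList [2 ^ e])).Dom ↔
        (StateTransition.eval (TM2.step step) (TM2.init K'.main (trList [2 ^ e]))).Dom :=
      Iff.rfl
    rw [← h1, TM1to0.tr_eval]
    refine (TM2to1.tr_eval_dom step K'.main _).trans (h3.trans ?_)
    rw [h2]
    exact iff_of_eq (congrArg Part.Dom (PartrecToTM2.tr_eval c [2 ^ e]))
  have hS := TM1to0.tr_supports _ (TM2to1.tr_supports _ (PartrecToTM2.tr_supports c Cont'.halt))
  have : Finite (TM2to1.Γ' K' (fun _ => PartrecToTM2.Γ')) := by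
    unfold TM2to1.Γ'
    infer_instance
  refine ⟨_, inferInstance,
    TM0.cellRule M _ (some ⟨default, hS.1⟩) bottom (sym .bit1) (sym .bit0), fun h => hc ?_⟩
  refine h.of_eq fun e => ?_
  rw [TM0.halts_cellRule_iff M _ hS, hM]

/-- There is a rule over the letters `2^O` with undecidable halting problem. -/
theorem exists_cellRule_outLetter_not_computablePred :
    ∃ (n : ℕ) (R : CellRule (OutLetter n)), ¬ ComputablePred R.Halts := by
  classical
  obtain ⟨A, _, R, hR⟩ := exists_cellRule_not_computablePred
  have := Fintype.ofFinite A
  let enc : A → OutLetter (Fintype.card A) := fun a i => decide (Fintype.equivFin A a = i)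
  have henc : Function.Injective enc := fun a b h => by
    have := congrFun h (Fintype.equivFin A a)
    simp only [enc, decide_true, Bool.true_eq, decide_eq_true_eq] at this
    exact ((Fintype.equivFin A).injective this).symm
  have : Nonempty A := ⟨R.first⟩
  refine ⟨_, R.map enc (Function.invFun enc), fun h => hR (h.of_eq fun e => ?_)⟩
  exact CellRule.halts_map R (Function.leftInverse_invFun henc) e

end Universal

end TuringMachines

/-! ### Computability of the rows -/

namespace CellRule

variable {A : Type} [Inhabited A]

/-- The rule applied to an initial segment of a row. -/
def nextList (R : CellRule A) (l : List A) : List A :=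
  (List.range (l.length - 1)).map fun p =>
    Nat.casesOn p (R.boundary (l.getI 0) (l.getI 1))
      fun q => R.interior (l.getI 0) (l.getI q) (l.getI (q + 1)) (l.getI (q + 2))

theorem nextList_map_range (R : CellRule A) (r : ℕ → A) (N : ℕ) :
    R.nextList ((List.range (N + 1)).map r) = (List.range N).map (R.next r) := by
  have h (i : ℕ) (hi : i < N + 1) : ((List.range (N + 1)).map r).getI i = r i := by
    rw [List.getI_eq_getElem _ (by simpa using hi)]
    simp
  rw [nextList, List.length_map, List.length_range, Nat.add_sub_cancel]
  refine List.map_congr_left fun p hp => ?_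
  rw [List.mem_range] at hp
  cases p with
  | zero =>
    show R.boundary _ _ = R.boundary _ _
    rw [h 0 (by omega), h 1 (by omega)]
  | succ p =>
    show R.interior _ _ _ _ = R.interior _ _ _ _
    rw [h 0 (by omega), h p (by omega), h (p + 1) (by omega), h (p + 2) (by omega)]

/-- Each step loses the last cell, whose right neighbour is unknown, so `t` steps consume `t` extra
initial cells. -/
theorem iterate_nextList (R : CellRule A) (e t N : ℕ) :
    R.nextList^[t] ((List.range (N + t)).map (R.init e)) = (List.range N).map (R.row e t) := by
  induction t generalizing N with
  | zero => rfl
  | succ t ih =>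
    rw [Function.iterate_succ_apply', show N + (t + 1) = N + 1 + t by omega, ih, nextList_map_range]
    rfl

variable [Primcodable A] [Finite A]

theorem primrec_nextList (R : CellRule A) : Primrec R.nextList := by
  have hI {f : List A × ℕ → ℕ} (hf : Primrec f) : Primrec fun x : List A × ℕ => x.1.getI (f x) :=
    (Primrec.list_getI (α := A)).comp Primrec.fst hf
  have hb : Primrec fun x : A × A => R.boundary x.1 x.2 := Primrec.dom_finite _
  have hi : Primrec fun x : A × A × A × A => R.interior x.1 x.2.1 x.2.2.1 x.2.2.2 :=
    Primrec.dom_finite _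
  refine Primrec.list_map (Primrec.list_range.comp (Primrec.nat_sub.comp Primrec.list_length
    (Primrec.const 1))) ?_
  refine Primrec.nat_casesOn Primrec.snd
    (hb.comp ((hI (Primrec.const 0)).pair (hI (Primrec.const 1)))) ?_
  have hI' {f : (List A × ℕ) × ℕ → ℕ} (hf : Primrec f) :
      Primrec fun x : (List A × ℕ) × ℕ => x.1.1.getI (f x) :=
    (Primrec.list_getI (α := A)).comp (Primrec.fst.comp Primrec.fst) hf
  exact hi.comp ((hI' (Primrec.const 0)).pair ((hI' Primrec.snd).pair
    ((hI' (Primrec.succ.comp Primrec.snd)).pair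
      (hI' (Primrec.succ.comp (Primrec.succ.comp Primrec.snd))))))

omit [Inhabited A] [Finite A] in
theorem primrec_init (R : CellRule A) (e : ℕ) : Primrec (R.init e) := by
  have : Primrec fun p : ℕ => Nat.casesOn (motive := fun _ => A) p R.first
      fun q => Nat.casesOn (motive := fun _ => A) q R.second
        fun s => if s < e then R.repeated else R.blank := by
    refine Primrec.nat_casesOn Primrec.id (Primrec.const _) ?_
    refine Primrec.nat_casesOn Primrec.snd (Primrec.const _) ?_
    exact Primrec.ite (Primrec.nat_lt.comp Primrec.snd (Primrec.const e)) (Primrec.const _)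
      (Primrec.const _)
  refine this.of_eq fun p => ?_
  match p with
  | 0 => rfl
  | 1 => rfl
  | p + 2 => rfl

theorem primrec₂_row (R : CellRule A) (e : ℕ) : Primrec₂ (R.row e) := by
  have h : Primrec fun x : ℕ × ℕ =>
      (R.nextList^[x.1] ((List.range (x.2 + 1 + x.1)).map (R.init e))).getI x.2 := by
    refine Primrec.list_getI.comp (Primrec.nat_iterate Primrec.fst (Primrec.list_map
      (Primrec.list_range.comp (Primrec.nat_add.comp (Primrec.succ.comp Primrec.snd)
        Primrec.fst)) ((R.primrec_init e).comp Primrec.snd)) ?_) Primrec.snd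
    exact R.primrec_nextList.comp Primrec.snd
  refine h.of_eq fun x => ?_
  rw [iterate_nextList, List.getI_eq_getElem _ (by simp)]
  simp

end CellRule

/-! ### The forced strategy and marked sessions -/

/-- The strategy that waits with empty outputs for the first session letter containing the input,
and then, if this letter has position `t`, writes the `t`-th row. -/
def CellRule.answer {n : ℕ} (R : CellRule (OutLetter n)) (e : ℕ) (v : List (InLetter 1)) :
    OutLetter n :=
  if v.findIdx (· 0) < v.length then
    R.row e (v.findIdx (· 0)) (v.length - (v.findIdx (· 0) + 1))
  else fun _ => false

theorem CellRule.primrec_answer {n : ℕ} (R : CellRule (OutLetter n)) (e : ℕ) :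
    Primrec (R.answer e) := by
  have h : Primrec fun v : List (InLetter 1) => v.findIdx (· 0) :=
    Primrec.list_findIdx Primrec.id ((Primrec.dom_finite fun x : InLetter 1 => x 0).comp
      Primrec.snd)
  exact Primrec.ite (Primrec.nat_lt.comp h Primrec.list_length)
    ((R.primrec₂_row e).comp h (Primrec.nat_sub.comp Primrec.list_length (Primrec.succ.comp h)))
    (Primrec.const _)

/-- The first position at which the session contains the input is `t`. -/
def MarkedAt (v : InfWord (InLetter 1)) (t : ℕ) : Prop :=
  v t 0 = true ∧ ∀ j < t, v j 0 = false

theorem MarkedAt.findIdx_first {v : InfWord (InLetter 1)} {t : ℕ} (h : MarkedAt v t) (p : ℕ) :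
    (v.first (t + 1 + p)).findIdx (· 0) = t := by
  rw [List.findIdx_eq (by simp [InfWord.first]; omega)]
  have hg (j : ℕ) (hj : j < ((List.range (t + 1 + p)).map v).length) :
      ((List.range (t + 1 + p)).map v)[j] = v j := by simp
  exact ⟨(congrFun (hg t _) 0).trans h.1, fun j hj => (congrFun (hg j _) 0).trans (h.2 j hj)⟩

theorem CellRule.answer_of_markedAt {n : ℕ} (R : CellRule (OutLetter n)) (e : ℕ)
    {v : InfWord (InLetter 1)} {t : ℕ} (h : MarkedAt v t) (p : ℕ) :
    R.answer e (v.first (t + 1 + p)) = R.row e t p := by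
  have hl : (v.first (t + 1 + p)).length = t + 1 + p := by simp [InfWord.first]
  rw [CellRule.answer, h.findIdx_first, hl, if_pos (by omega), Nat.add_sub_cancel_left]

theorem CellRule.answer_of_forall_false {n : ℕ} (R : CellRule (OutLetter n)) (e : ℕ)
    {v : InfWord (InLetter 1)} {j : ℕ} (h : ∀ i < j, v i 0 = false) :
    R.answer e (v.first j) = fun _ => false := by
  rw [CellRule.answer, if_neg]
  rw [List.findIdx_lt_length]
  rintro ⟨x, hx, h0⟩
  simp only [InfWord.first, List.mem_map, List.mem_range] at hx
  obtain ⟨i, hi, rfl⟩ := hx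
  simp [h i hi] at h0

theorem exists_markedAt_or (v : InfWord (InLetter 1)) :
    (∃ t, MarkedAt v t) ∨ ∀ i, v i 0 = false := by
  classical
  by_cases h : ∃ t, v t 0 = true
  · exact Or.inl ⟨Nat.find h, Nat.find_spec h, fun j hj => by simpa using Nat.find_min h hj⟩
  · exact Or.inr (by simpa using h)

/-- The session in which the input occurs exactly at position `t`. -/
def markSession (t : ℕ) : InfWord (InLetter 1) := fun j _ => decide (j = t)

theorem markedAt_markSession (t : ℕ) : MarkedAt (markSession t) t :=
  ⟨by simp [markSession], fun j hj => by simp [markSession]; omega⟩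

/-! ### Definability by quantifier-free formulas -/

/-- `P` is definable by a quantifier-free formula over the trace variables `0` and `1`. -/
def Expressible {m n : ℕ} (P : (ℕ → InfWord (Letter m n)) → Prop) : Prop :=
  ∃ p : HyperBody (Fin m ⊕ Fin n), p.vars ⊆ {0, 1} ∧ ∀ A, p.Sat A ↔ P A

namespace Expressible

variable {m n : ℕ} {P Q : (ℕ → InfWord (Letter m n)) → Prop}

theorem of_iff (h : Expressible P) (hPQ : ∀ A, P A ↔ Q A) : Expressible Q := by
  obtain ⟨p, hv, hp⟩ := h
  exact ⟨p, hv, fun A => (hp A).trans (hPQ A)⟩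

theorem atom (a : Fin m ⊕ Fin n) {x : ℕ} (hx : x < 2) :
    Expressible fun A : ℕ → InfWord (Letter m n) => (A x 0).Has a := by
  refine ⟨.atom a x, ?_, fun A => Iff.rfl⟩
  rw [HyperBody.vars, Set.singleton_subset_iff]
  simp only [Set.mem_insert_iff, Set.mem_singleton_iff]
  omega

theorem not (h : Expressible P) : Expressible fun A => ¬ P A := by
  obtain ⟨p, hv, hp⟩ := h
  exact ⟨.neg p, hv, fun A => not_congr (hp A)⟩

theorem or (h : Expressible P) (h' : Expressible Q) : Expressible fun A => P A ∨ Q A := by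
  obtain ⟨p, hv, hp⟩ := h
  obtain ⟨q, hv', hq⟩ := h'
  exact ⟨.or p q, Set.union_subset hv hv', fun A => or_congr (hp A) (hq A)⟩

theorem and (h : Expressible P) (h' : Expressible Q) : Expressible fun A => P A ∧ Q A :=
  (h.not.or h'.not).not.of_iff fun A => by tauto

theorem imp (h : Expressible P) (h' : Expressible Q) : Expressible fun A => P A → Q A :=
  (h.not.or h').of_iff fun A => by tauto

theorem untl (h : Expressible P) (h' : Expressible Q) :
    Expressible fun A => ∃ i, Q (fun x => (A x).suffix i) ∧ ∀ j < i, P fun x => (A x).suffix j := by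
  obtain ⟨p, hv, hp⟩ := h
  obtain ⟨q, hv', hq⟩ := h'
  refine ⟨.untl p q, Set.union_subset hv hv', fun A => ?_⟩
  simp only [HyperBody.Sat, hp, hq]

/-- The syntax has no constants; a tautology needs some proposition, here an input. -/
theorem true : Expressible fun _ : ℕ → InfWord (Letter (m + 1) n) => True :=
  ((atom (Sum.inl 0) zero_lt_two).imp (atom (Sum.inl 0) zero_lt_two)).of_iff fun A => by tauto

/-- With finitely many letters, an arbitrary local rule becomes a finite conjunction of implications
between letter values. -/
theorem forall_finite {m : ℕ} {X : Type*} [Finite X]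
    {P : X → (ℕ → InfWord (Letter (m + 1) n)) → Prop} (h : ∀ x, Expressible (P x)) :
    Expressible fun A => ∀ x, P x A := by
  have := Fintype.ofFinite X
  suffices ∀ s : Finset X, Expressible fun A => ∀ x ∈ s, P x A from
    (this Finset.univ).of_iff fun A => by simp
  intro s
  induction s using Finset.cons_induction with
  | empty => exact true.of_iff fun A => by simp
  | cons x s hx ih => exact ((h x).and ih).of_iff fun A => by simp

theorem suffix (h : Expressible P) (k : ℕ) :
    Expressible fun A => P fun x => (A x).suffix k := by
  induction k generalizing P with
  | zero =>
    refine h.of_iff fun A => iff_of_eq (congrArg P ?_)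
    funext x j
    simp [InfWord.suffix]
  | succ k ih =>
    obtain ⟨p, hv, hp⟩ := ih h
    refine ⟨.next p, hv, fun A => (hp _).trans (iff_of_eq (congrArg P ?_))⟩
    funext x j
    simp only [InfWord.suffix]
    congr 1
    omega

theorem always {m : ℕ} {P : (ℕ → InfWord (Letter (m + 1) n)) → Prop} (h : Expressible P) :
    Expressible fun A => ∀ i, P fun x => (A x).suffix i :=
  (true.untl h.not).not.of_iff fun A => by simp

theorem input (i : Fin m) {x : ℕ} (hx : x < 2) (k : ℕ) (b : Bool) :
    Expressible fun A : ℕ → InfWord (Letter m n) => (A x k).1 i = b := by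
  have h := (atom (n := n) (Sum.inl i) hx).suffix k
  cases b
  · exact h.not.of_iff fun A => by simp [InfWord.suffix, Letter.Has]
  · exact h.of_iff fun A => by simp [InfWord.suffix, Letter.Has]

theorem output {m : ℕ} {x : ℕ} (hx : x < 2) (k : ℕ) (a : OutLetter n) :
    Expressible fun A : ℕ → InfWord (Letter (m + 1) n) => (A x k).2 = a := by
  refine (forall_finite (X := Fin n)
    (P := fun o A => (A x k).2 o = a o) fun o => ?_).of_iff fun A => funext_iff.symm
  have h := (atom (m := m + 1) (n := n) (Sum.inr o) hx).suffix k
  cases a o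
  · exact h.not.of_iff fun A => by simp [InfWord.suffix, Letter.Has]
  · exact h.of_iff fun A => by simp [InfWord.suffix, Letter.Has]

end Expressible

/-! ### The constraints on pairs of sessions and their formulas -/

/-- The inputs of a trace. -/
def InfWord.inputs {m n : ℕ} (w : InfWord (Letter m n)) : InfWord (InLetter m) := fun j => (w j).1

/-- The constraints on an ordered pair of sessions: outputs are empty up to the first occurrence of
the input; a session marked at `0` writes the initial row; no row written after the mark is
terminal; the row of a session marked at `t + 1` is the successor of the row of a session marked
at `t`. -/
structure CellRule.Consistent {n : ℕ} (R : CellRule (OutLetter n)) (e : ℕ)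
    (a b : InfWord (Letter 1 n)) : Prop where
  empty : ∀ j, (∀ k < j, a.inputs k 0 = false) → (a j).2 = fun _ => false
  init : a.inputs 0 0 = true → ∀ p, (a (p + 1)).2 = R.init e p
  not_halted : ∀ t, MarkedAt a.inputs t → (a (t + 1)).2 ∉ R.halted
  next : ∀ t, MarkedAt a.inputs t → MarkedAt b.inputs (t + 1) →
    ∀ p, (b (t + 2 + p)).2 = R.next (fun q => (a (t + 1 + q)).2) p

/-- The part of the constraints that does not depend on the parameter of the initial row. -/
structure CellRule.PreConsistent {n : ℕ} (R : CellRule (OutLetter n))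
    (a b : InfWord (Letter 1 n)) : Prop where
  empty : ∀ j, (∀ k < j, a.inputs k 0 = false) → (a j).2 = fun _ => false
  init : a.inputs 0 0 = true → (a 1).2 = R.first ∧ (a 2).2 = R.second
  not_halted : ∀ t, MarkedAt a.inputs t → (a (t + 1)).2 ∉ R.halted
  next : ∀ t, MarkedAt a.inputs t → MarkedAt b.inputs (t + 1) →
    ∀ p, (b (t + 2 + p)).2 = R.next (fun q => (a (t + 1 + q)).2) p

/-- This isolates the dependence on `e` in one clause whose formula can be written explicitly. -/
theorem CellRule.consistent_iff {n : ℕ} (R : CellRule (OutLetter n)) (e : ℕ)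
    (a b : InfWord (Letter 1 n)) :
    R.Consistent e a b ↔ R.PreConsistent a b ∧ (a.inputs 0 0 = true →
      ∀ p, (a (p + 3)).2 = if p < e then R.repeated else R.blank) := by
  constructor
  · intro h
    exact ⟨⟨h.empty, fun h0 => ⟨h.init h0 0, h.init h0 1⟩, h.not_halted, h.next⟩,
      fun h0 p => h.init h0 (p + 2)⟩
  · rintro ⟨h, h'⟩
    refine ⟨h.empty, fun h0 p => ?_, h.not_halted, h.next⟩
    match p with
    | 0 => exact (h.init h0).1
    | 1 => exact (h.init h0).2
    | p + 2 => exact h' h0 p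

/-- Clauses about the first mark are negated untils: the until runs along the unmarked positions and
looks for a violation at its end. -/
theorem CellRule.expressible_preConsistent {n : ℕ} (R : CellRule (OutLetter n)) :
    Expressible fun A : ℕ → InfWord (Letter 1 n) => R.PreConsistent (A 0) (A 1) := by
  have h01 : (0 : ℕ) < 2 := zero_lt_two
  have h11 : (1 : ℕ) < 2 := one_lt_two
  have hnone := Expressible.input (n := n) (0 : Fin 1) h01 0 false
  have hempty : Expressible fun A : ℕ → InfWord (Letter 1 n) =>
      ∀ j, (∀ k < j, (A 0).inputs k 0 = false) → (A 0 j).2 = fun _ => false :=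
    (hnone.untl (Expressible.output h01 0 (fun _ => false)).not).not.of_iff fun A => by
      simp only [InfWord.suffix, InfWord.inputs, add_zero]
      grind
  have hinit : Expressible fun A : ℕ → InfWord (Letter 1 n) =>
      (A 0).inputs 0 0 = true → (A 0 1).2 = R.first ∧ (A 0 2).2 = R.second :=
    (Expressible.input 0 h01 0 true).imp
      ((Expressible.output h01 1 R.first).and (Expressible.output h01 2 R.second))
  have hhalt : Expressible fun A : ℕ → InfWord (Letter 1 n) => (A 0 1).2 ∉ R.halted :=
    (Expressible.forall_finite (X := R.halted) fun x =>
      (Expressible.output h01 1 x.1).not).of_iff fun A =>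
        ⟨fun h hA => h ⟨_, hA⟩ rfl, fun h x hx => h (hx ▸ x.2)⟩
  have hnot_halted : Expressible fun A : ℕ → InfWord (Letter 1 n) =>
      ∀ t, MarkedAt (A 0).inputs t → (A 0 (t + 1)).2 ∉ R.halted :=
    (hnone.untl ((Expressible.input 0 h01 0 true).and hhalt.not)).not.of_iff fun A => by
      simp only [InfWord.suffix, InfWord.inputs, add_zero, MarkedAt]
      grind
  have hzero : Expressible fun A : ℕ → InfWord (Letter 1 n) =>
      (A 1 2).2 = R.boundary (A 0 1).2 (A 0 2).2 :=
    (Expressible.forall_finite (X := OutLetter n × OutLetter n) fun x =>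
      (Expressible.output h01 1 x.1).imp ((Expressible.output h01 2 x.2).imp
        (Expressible.output h11 2 (R.boundary x.1 x.2)))).of_iff fun A => by
          simp only [Prod.forall]
          grind
  have hsucc : Expressible fun A : ℕ → InfWord (Letter 1 n) =>
      ∀ p, (A 1 (p + 3)).2 =
        R.interior (A 0 1).2 (A 0 (p + 1)).2 (A 0 (p + 2)).2 (A 0 (p + 3)).2 := by
    -- The head letter is fixed outside `always` because every cell of the row reads it; the
    -- neighbouring letters are read inside and move with the position.
    refine (Expressible.forall_finite (X := OutLetter n) fun x =>
      (Expressible.output h01 1 x).imp (Expressible.forall_finite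
        (X := OutLetter n × OutLetter n × OutLetter n) fun y =>
        (Expressible.output h01 1 y.1).imp ((Expressible.output h01 2 y.2.1).imp
          ((Expressible.output h01 3 y.2.2).imp
            (Expressible.output h11 3 (R.interior x y.1 y.2.1 y.2.2))))).always).of_iff
      fun A => ?_
    simp only [Prod.forall, InfWord.suffix]
    grind
  have hrow : Expressible fun A : ℕ → InfWord (Letter 1 n) =>
      ∀ p, (A 1 (p + 2)).2 = R.next (fun q => (A 0 (q + 1)).2) p :=
    (hzero.and hsucc).of_iff fun A => ⟨fun h p => by
      cases p with
      | zero => exact h.1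
      | succ p => exact h.2 p, fun h => ⟨h 0, fun p => h (p + 1)⟩⟩
  have hnext : Expressible fun A : ℕ → InfWord (Letter 1 n) =>
      ∀ t, MarkedAt (A 0).inputs t → MarkedAt (A 1).inputs (t + 1) →
        ∀ p, (A 1 (t + 2 + p)).2 = R.next (fun q => (A 0 (t + 1 + q)).2) p := by
    -- The second session is marked one position later, so it is still unmarked where the first one
    -- has its mark.
    refine ((hnone.and (Expressible.input 0 h11 0 false)).untl
      (((Expressible.input 0 h01 0 true).and ((Expressible.input 0 h11 0 false).and
        (Expressible.input 0 h11 1 true))).and hrow.not)).not.of_iff fun A => ?_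
    have e1 (t p : ℕ) : t + 2 + p = t + (p + 2) := by omega
    have e2 (t p : ℕ) : t + 1 + p = t + (p + 1) := by omega
    simp only [MarkedAt, InfWord.suffix, InfWord.inputs, add_zero, e1, e2]
    grind
  exact (hempty.and (hinit.and (hnot_halted.and hnext))).of_iff fun A =>
    ⟨fun h => ⟨h.1, h.2.1, h.2.2.1, h.2.2.2⟩,
      fun h => ⟨h.empty, h.init, h.not_halted, h.next⟩⟩

/-- The conjunction of two quantifier-free formulas. -/
def HyperBody.and {AP : Type} (p q : HyperBody AP) : HyperBody AP := .neg (.or (.neg p) (.neg q))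

theorem HyperBody.sat_and {m n : ℕ} (p q : HyperBody (Fin m ⊕ Fin n))
    (A : ℕ → InfWord (Letter m n)) : (p.and q).Sat A ↔ p.Sat A ∧ q.Sat A := by
  simp only [HyperBody.and, HyperBody.Sat]
  tauto

theorem HyperBody.code_and {AP : Type} [Encodable AP] (p q : HyperBody AP) :
    (p.and q).code = 5 * (5 * Nat.pair (5 * p.code + 1) (5 * q.code + 1) + 2) + 1 := rfl

/-- The formula `p ∧ ○ (p ∧ ○ ( ⋯ ∧ ○ q))` with `e` copies of `p`. -/
def HyperBody.repeat {AP : Type} (p q : HyperBody AP) : ℕ → HyperBody AP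
  | 0 => q
  | e + 1 => p.and (.next (p.repeat q e))

theorem HyperBody.vars_repeat_subset {AP : Type} {p q : HyperBody AP} {s : Set ℕ}
    (hp : p.vars ⊆ s) (hq : q.vars ⊆ s) (e : ℕ) : (p.repeat q e).vars ⊆ s := by
  induction e with
  | zero => exact hq
  | succ e ih => exact Set.union_subset hp ih

theorem HyperBody.primrec_code_repeat {AP : Type} [Encodable AP] (p q : HyperBody AP) :
    Primrec fun e => (p.repeat q e).code := by
  have hlin (k : ℕ) {f : ℕ × ℕ → ℕ} (hf : Primrec f) : Primrec fun x => 5 * f x + k :=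
    Primrec.nat_add.comp (Primrec.nat_mul.comp (Primrec.const 5) hf) (Primrec.const k)
  have h : Primrec₂ fun _ c : ℕ => 5 * (5 * Nat.pair (5 * p.code + 1) (5 * (5 * c + 3) + 1) + 2) + 1 :=
    hlin 1 (hlin 2 (Primrec₂.natPair.comp (Primrec.const _) (hlin 1 (hlin 3 Primrec.snd))))
  refine (Primrec.nat_rec₁ q.code h).of_eq fun e => ?_
  induction e with
  | zero => rfl
  | succ e ih => rw [HyperBody.repeat, HyperBody.code_and, HyperBody.code, ← ih]

/-- `Expressible` gives no control over codes, so it supplies only four formulas chosen once for all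
`e`; the parameter enters through the explicit recursion `HyperBody.repeat`, which keeps the code
primitive recursive. -/
theorem CellRule.exists_body {n : ℕ} (R : CellRule (OutLetter n)) :
    ∃ ψ : ℕ → HyperBody (Fin 1 ⊕ Fin n), (∀ e, (ψ e).vars ⊆ {0, 1}) ∧
      (∀ e A, (ψ e).Sat A ↔ R.Consistent e (A 0) (A 1)) ∧
      Primrec fun e => (ψ e).code := by
  have h01 : (0 : ℕ) < 2 := zero_lt_two
  obtain ⟨c, hcv, hc⟩ := R.expressible_preConsistent
  obtain ⟨u, huv, hu⟩ := Expressible.input (m := 1) (n := n) 0 h01 0 false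
  obtain ⟨y, hyv, hy⟩ := Expressible.output (m := 0) h01 0 R.repeated
  obtain ⟨z, hzv, hz⟩ := (Expressible.output (m := 0) h01 0 R.blank).always
  have hrep (e : ℕ) (A : ℕ → InfWord (Letter 1 n)) : (y.repeat z e).Sat A ↔
      ∀ p, (A 0 p).2 = if p < e then R.repeated else R.blank := by
    induction e generalizing A with
    | zero => simp [HyperBody.repeat, hz, InfWord.suffix]
    | succ e ih =>
      rw [HyperBody.repeat, HyperBody.sat_and, hy, HyperBody.Sat, ih]
      constructor
      · rintro ⟨h0, h1⟩ p
        cases p with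
        | zero => simpa using h0
        | succ p => simpa [InfWord.suffix, add_comm 1 p] using h1 p
      · intro h
        exact ⟨by simpa using h 0, fun p => by
          simpa [InfWord.suffix, add_comm 1 p] using h (p + 1)⟩
  -- A session marked at `0` writes its row from position `1`, and `c` treats the first two letters,
  -- so the block starts after three `next`.
  refine ⟨fun e => c.and (.or u (.next (.next (.next (y.repeat z e))))), fun e => ?_,
    fun e A => ?_, ?_⟩
  · exact Set.union_subset hcv (Set.union_subset huv (HyperBody.vars_repeat_subset hyv hzv e))
  · rw [HyperBody.sat_and, hc, R.consistent_iff]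
    refine and_congr_right fun _ => ?_
    simp only [HyperBody.Sat, hu, hrep, InfWord.suffix, InfWord.inputs]
    have e3 (p : ℕ) : 1 + (1 + (1 + p)) = p + 3 := by omega
    simp only [e3]
    grind
  · have hlin (k : ℕ) {f : ℕ → ℕ} (hf : Primrec f) : Primrec fun x => 5 * f x + k :=
      Primrec.nat_add.comp (Primrec.nat_mul.comp (Primrec.const 5) hf) (Primrec.const k)
    exact hlin 1 (hlin 2 (Primrec₂.natPair.comp (Primrec.const _) (hlin 1 (hlin 2
      (Primrec₂.natPair.comp (Primrec.const _) (hlin 3 (hlin 3 (hlin 3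
        (HyperBody.primrec_code_repeat y z)))))))))

theorem CellRule.exists_formula {n : ℕ} (R : CellRule (OutLetter n)) :
    ∃ φ : ℕ → HyperLTL (Fin 1 ⊕ Fin n), (∀ e, (φ e).IsUniversal ∧ (φ e).IsClosed) ∧
      (∀ e T, T ∈ (φ e).hyperproperty ↔ ∀ a ∈ T, ∀ b ∈ T, R.Consistent e a b) ∧
      Primrec fun e => (φ e).code := by
  obtain ⟨ψ, hv, hψ, hc⟩ := R.exists_body
  refine ⟨fun e => .all 0 (.all 1 (.body (ψ e))), fun e => ⟨trivial, ?_⟩, fun e T => ?_, ?_⟩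
  · refine Set.eq_empty_of_forall_notMem fun x hx => ?_
    simp only [HyperLTL.freeVars, Set.mem_sdiff, Set.mem_singleton_iff] at hx
    have := hv e hx.1.1
    simp only [Set.mem_insert_iff, Set.mem_singleton_iff] at this
    tauto
  · simp only [HyperLTL.hyperproperty, Set.mem_ofPred_eq, HyperLTL.Sat, hψ, Function.update_self]
    rfl
  · have hlin (k : ℕ) {f : ℕ → ℕ} (hf : Primrec f) : Primrec fun x => 3 * f x + k :=
      Primrec.nat_add.comp (Primrec.nat_mul.comp (Primrec.const 3) hf) (Primrec.const k)
    exact hlin 1 (Primrec₂.natPair.comp (Primrec.const _)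
      (hlin 1 (Primrec₂.natPair.comp (Primrec.const _) (hlin 0 hc))))

/-! ### Prefixes, memoryless systems and plays -/

section Prefixes

theorem InfWord.length_first {A : Type} (w : InfWord A) (k : ℕ) : (w.first k).length = k := by
  simp [InfWord.first]

theorem InfWord.getElem_first {A : Type} (w : InfWord A) {k j : ℕ} (h : j < (w.first k).length) :
    (w.first k)[j] = w j := by
  simp [InfWord.first]

theorem InfWord.take_first {A : Type} (w : InfWord A) {k j : ℕ} (h : j ≤ k) :
    (w.first k).take j = w.first j := by
  rw [InfWord.first, ← List.map_take, List.take_range, min_eq_left h, InfWord.first]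

theorem InfWord.first_prepend {A : Type} (u : List A) (w : InfWord A) {j : ℕ}
    (h : j ≤ u.length) : (InfWord.prepend u w).first j = u.take j := by
  refine List.ext_getElem (by simp [InfWord.length_first, h]) fun i h1 h2 => ?_
  rw [InfWord.length_first] at h1
  have hi : i < u.length := by omega
  simp [InfWord.getElem_first, InfWord.prepend, hi]

theorem InfWord.inputs_first {m n : ℕ} (w : InfWord (Letter m n)) (j : ℕ) :
    w.inputs.first j = (w.first j).map Prod.fst := by
  simp only [InfWord.first, List.map_map]
  rfl

theorem SeqSystem.run_of_memoryless {m n : ℕ} (s : List (InLetter m) → OutLetter n)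
    (p : SeqPrefix (InLetter m)) :
    (SeqSystem.run (fun _ => s) p) =
      (p.1.map (respond s), List.ofFn fun j : Fin p.2.length => (p.2[j], s (p.2.take j))) := by
  refine Prod.ext ?_ rfl
  exact List.ext_getElem (by simp [SeqSystem.run]) fun i h1 h2 => by simp [SeqSystem.run]

/-- Transparency of a mechanism that always answers by the same function reduces to this
monotonicity. -/
theorem SeqSystem.run_le_run_of_memoryless {m n : ℕ} (s : List (InLetter m) → OutLetter n)
    {p q : SeqPrefix (InLetter m)} (h : p.Le q) :
    (SeqSystem.run (fun _ => s) p).Le (SeqSystem.run (fun _ => s) q) := by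
  simp only [run_of_memoryless]
  rcases h with ⟨h1, h2⟩ | ⟨w, W, h1, h2⟩
  · refine Or.inl ⟨congrArg (List.map _) h1, ?_⟩
    have hl := h2.length_le
    refine List.prefix_iff_eq_take.2 (List.ext_getElem (by simp [hl]) fun i hi hi' => ?_)
    simp only [List.length_ofFn] at hi
    obtain ⟨r, hr⟩ := h2
    simp [← hr, hi, List.getElem_append, List.take_append_of_le_length hi.le]
  · refine Or.inr ⟨respond s w, W.map (respond s), by simp [h1], ?_⟩
    simp only [List.length_ofFn]
    refine List.ext_getElem (by simp [InfWord.length_first]) fun i hi hi' => ?_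
    simp only [List.length_ofFn] at hi
    have hw : p.2[i] = w i := by
      rw [List.getElem_of_eq h2, InfWord.getElem_first]
    have ht : p.2.take i = w.first i := by
      conv_lhs => rw [h2]
      exact InfWord.take_first w hi.le
    simp [InfWord.getElem_first, respond, hw, ht]

/-- The trace set of a play contains the finished sessions, the continuation of the current session,
and sessions for the later inputs. -/
theorem SeqStrategy.mem_play {m n : ℕ} (σ : SeqStrategy m n) (p : SeqPrefix (Letter m n))
    (V : ℕ → InfWord (InLetter m)) :
    (∀ t ∈ p.1, t ∈ σ.play p V 0) ∧
    (∃ w, InfWord.prepend p.2 w ∈ σ.play p V 0) ∧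
    ∀ k, ∃ t ∈ σ.play p V (k + 1), t.inputs = V (k + 1) := by
  refine ⟨fun t ht => ?_, ⟨respond (σ p) (V 0), ?_⟩, fun k =>
    ⟨respond (σ (σ.play p V k, [])) (V (k + 1)), ?_, rfl⟩⟩
  all_goals simp only [SeqStrategy.play, List.mem_append, List.mem_singleton]
  · exact Or.inl ht
  · exact Or.inr trivial
  · exact Or.inr trivial

end Prefixes

/-! ### Enforceability is equivalent to not halting -/

namespace CellRule

variable {n : ℕ} (R : CellRule (OutLetter n)) (e : ℕ)

/-- True rows satisfy the initial and successor constraints by construction; that the machine never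
halts is needed only to exclude terminal rows. -/
theorem consistent_respond_answer (h : ¬ R.Halts e) (v w : InfWord (InLetter 1)) :
    R.Consistent e (respond (R.answer e) v) (respond (R.answer e) w) where
  empty j hj := R.answer_of_forall_false e hj
  init h0 p := by
    have hm : MarkedAt v 0 := ⟨h0, by simp⟩
    have := R.answer_of_markedAt e hm p
    rwa [zero_add, add_comm 1 p] at this
  not_halted t ht hb := h ⟨t, by
    rw [← R.answer_of_markedAt e ht 0]
    exact hb⟩
  next t ht ht' p := by
    have h1 (q : ℕ) : (respond (R.answer e) v (t + 1 + q)).2 = R.row e t q :=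
      R.answer_of_markedAt e ht q
    simp only [h1]
    exact R.answer_of_markedAt e ht' p

variable {R e} {T : Set (InfWord (Letter 1 n))}

/-- Induction on `t`: a session marked at `t` fixes all sessions marked at `t + 1`, and a mark at
`0` forces the initial row. -/
theorem output_eq_row (hT : ∀ a ∈ T, ∀ b ∈ T, R.Consistent e a b)
    (hm : ∀ t, ∃ a ∈ T, MarkedAt a.inputs t) {t : ℕ} {a : InfWord (Letter 1 n)} (ha : a ∈ T)
    (hat : MarkedAt a.inputs t) (p : ℕ) : (a (t + 1 + p)).2 = R.row e t p := by
  induction t generalizing a p with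
  | zero =>
    rw [zero_add, add_comm 1 p]
    exact (hT a ha a ha).init hat.1 p
  | succ t ih =>
    obtain ⟨b, hb, hbt⟩ := hm t
    rw [(hT b hb a ha).next t hbt hat p, row]
    congr 1
    funext q
    exact ih hb hbt q

/-- In a consistent trace set in which all marks occur, the outputs are forced. -/
theorem output_eq_answer (hT : ∀ a ∈ T, ∀ b ∈ T, R.Consistent e a b)
    (hm : ∀ t, ∃ a ∈ T, MarkedAt a.inputs t) {a : InfWord (Letter 1 n)} (ha : a ∈ T) (j : ℕ) :
    (a j).2 = R.answer e (a.inputs.first j) := by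
  by_cases hj : ∀ k < j, a.inputs k 0 = false
  · rw [(hT a ha a ha).empty j hj, R.answer_of_forall_false e hj]
  · rcases exists_markedAt_or a.inputs with ⟨t, ht⟩ | h
    · have htj : t < j := by
        by_contra hc
        exact hj fun k hk => ht.2 k (by omega)
      obtain ⟨p, rfl⟩ := Nat.exists_eq_add_of_le (Nat.succ_le_of_lt htj)
      rw [output_eq_row hT hm ha ht p, R.answer_of_markedAt e ht p]
    · exact absurd (fun k _ => h k) hj

variable {H : Hyperproperty 1 n}

/-- A winning strategy must survive an environment that requests every row in later sessions. The
resulting trace set then forces all outputs, including those already made in the prefix. -/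
theorem run_eq_of_winning (hH : ∀ T, T ∈ H ↔ ∀ a ∈ T, ∀ b ∈ T, R.Consistent e a b)
    (S : SeqSystem 1 n) (s : SeqPrefix (InLetter 1)) (hs : (S.run s).Winning H) :
    S.run s = SeqSystem.run (fun _ => R.answer e) s := by
  obtain ⟨σ, hσ⟩ := hs
  simp only [SeqStrategy.Losing, not_exists, not_not, hH] at hσ
  -- The input with index `0` only completes the current session, whose start is already fixed, so
  -- mark `t` is placed in session `t + 1`.
  have hT := hσ fun k => markSession (k - 1)
  obtain ⟨h1, ⟨w, h2⟩, h3⟩ := σ.mem_play (S.run s) fun k => markSession (k - 1)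
  have hm : ∀ t, ∃ a ∈ {a | ∃ k, a ∈ σ.play (S.run s) (fun k => markSession (k - 1)) k},
      MarkedAt a.inputs t := by
    intro t
    obtain ⟨a, ha, hi⟩ := h3 t
    exact ⟨a, ⟨_, ha⟩, hi ▸ markedAt_markSession t⟩
  rw [SeqSystem.run_of_memoryless]
  refine Prod.ext (List.ext_getElem (by simp [SeqSystem.run]) fun i hi hi' => ?_)
    (List.ext_getElem (by simp [SeqSystem.run]) fun i hi hi' => ?_)
  · have hi₁ : i < s.1.length := by simpa [SeqSystem.run] using hi
    have hmem := h1 _ (List.getElem_mem hi)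
    have hout := output_eq_answer hT hm ⟨0, hmem⟩
    have hx : (S.run s).1[i] = respond (S (s.1.take i)) s.1[i] := by simp [SeqSystem.run]
    funext j
    have hj := hout j
    rw [hx] at hj ⊢
    rw [List.getElem_map]
    exact Prod.ext rfl hj
  · have hl : (S.run s).2.length = s.2.length := by simp [SeqSystem.run]
    have hj := output_eq_answer hT hm ⟨0, h2⟩ i
    -- The forced output depends only on earlier inputs, which lie inside the finite current
    -- session, so the continuation `w` is irrelevant.
    rw [InfWord.inputs_first, InfWord.first_prepend _ _ hi.le, InfWord.prepend, dif_pos hi,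
      List.map_take] at hj
    have hmap : (S.run s).2.map Prod.fst = s.2 :=
      List.ext_getElem (by simp [SeqSystem.run]) fun i _ _ => by simp [SeqSystem.run]
    rw [hmap] at hj
    refine Prod.ext (by simp [SeqSystem.run]) ?_
    rw [hj]
    simp

/-- The mechanism reads only the inputs of the current session and writes the true rows, so no
finished session has to be queried. -/
theorem enforceable_of_not_halts (hH : ∀ T, T ∈ H ↔ ∀ a ∈ T, ∀ b ∈ T, R.Consistent e a b)
    (h : ¬ R.Halts e) : Enforceable H := by
  refine ⟨fun _ _ => R.answer e, ⟨fun x => some (R.answer e (x.2.2.1.map Prod.fst)), ?_, ?_⟩,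
    fun S V => (hH _).2 ?_, fun S s s' hs hle => ?_⟩
  · refine Primrec.to_comp (Primrec.option_some.comp ((R.primrec_answer e).comp
      (Primrec.list_map (Primrec.fst.comp (Primrec.snd.comp Primrec.snd)) ?_)))
    exact Primrec.fst.comp Primrec.snd
  · intro S V v
    have hmap : (S.run (V, v)).2.map Prod.fst = v :=
      List.ext_getElem (by simp [SeqSystem.run]) fun i _ _ => by simp [SeqSystem.run]
    simp only [hmap, Option.some.injEq]
    exact ⟨⟨0, trivial⟩, fun _ o ho => ho.symm⟩
  · rintro _ ⟨i, rfl⟩ _ ⟨j, rfl⟩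
    exact R.consistent_respond_answer e h _ _
  · rw [run_eq_of_winning hH S s hs]
    exact SeqSystem.run_le_run_of_memoryless _ hle

/-- Requesting all rows forces a sound mechanism to write the terminal row, which the constraints
forbid. -/
theorem not_halts_of_enforceable (hH : ∀ T, T ∈ H ↔ ∀ a ∈ T, ∀ b ∈ T, R.Consistent e a b)
    (h : Enforceable H) : ¬ R.Halts e := by
  rintro ⟨t, ht⟩
  obtain ⟨enf, -, hsound, -⟩ := h
  -- Any system would do here; session `k` requests row `k`.
  have hT := (hH _).1 (hsound (fun _ _ _ => false) markSession)
  set S := enf fun _ _ _ => false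
  have hm (k : ℕ) : MarkedAt (S.session markSession k).inputs k := markedAt_markSession k
  have hmem (k : ℕ) : S.session markSession k ∈ Set.range (S.session markSession) := ⟨k, rfl⟩
  refine (hT _ (hmem t) _ (hmem t)).not_halted t (hm t) ?_
  rw [← add_zero (t + 1), output_eq_row hT (fun k => ⟨_, hmem k, hm k⟩) (hmem t) (hm t) 0]
  exact ht

end CellRule

/-- No algorithm decides, given the numbers `m` and `n` of inputs and outputs and a closed universal
HyperLTL formula over them, whether the formula is enforceable in the sequential model. -/
theorem theorem1 :
    ¬ ∃ f : ℕ × ℕ × ℕ → Bool, Computable f ∧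
      ∀ (m n : ℕ) (φ : HyperLTL (Fin m ⊕ Fin n)), φ.IsUniversal → φ.IsClosed →
        (f (m, n, φ.code) = true ↔ Enforceable φ.hyperproperty) := by
  rintro ⟨f, hf, h⟩
  obtain ⟨n, R, hR⟩ := exists_cellRule_outLetter_not_computablePred
  obtain ⟨φ, hφ, hφs, hφc⟩ := R.exists_formula
  -- The answer is negated because enforceability corresponds to not halting.
  refine hR (ComputablePred.computable_iff.2 ⟨fun e => !f (1, n, (φ e).code), ?_, ?_⟩)
  · exact Primrec.not.to_comp.comp (hf.comp ((Computable.const 1).pair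
      ((Computable.const n).pair hφc.to_comp)))
  · funext e
    have he := h 1 n (φ e) (hφ e).1 (hφ e).2
    have hiff : Enforceable (φ e).hyperproperty ↔ ¬ R.Halts e :=
      ⟨CellRule.not_halts_of_enforceable (hφs e), CellRule.enforceable_of_not_halts (hφs e)⟩
    rw [hiff] at he
    simp only [Bool.not_eq_true', ← Bool.not_eq_true, he, not_not]
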